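/- Let $q$ be a complex number with $|q|<1$. For $k\ge 1$ let $$E_{2k}(q)=1-\frac{4k}{B_{2k}}\sum_{n\ge1}\sigma_{2k-1}(n)q^n,\qquad \sigma_{j}(n)=\sum_{d\mid n}d^{j},$$ where $B_{2k}$ is the $2k$-th Bernoulli number, and for an integer $t\ge 0$ let $$V_{2t}(q)=\frac{\sum_{n\in\mathbb Z}(-1)^n(6n-1)^{2t}q^{n(3n-1)/2}}{\sum_{n\in\mathbb Z}(-1)^nq^{n(3n-1)/2}} =\frac{1^{2t}-5^{2t}q-7^{2t}q^2+11^{2t}q^5+13^{2t}q^7-\cdots}{1-q-q^2+q^5+q^7-\cdots}.$$ Define integers $c_v(\alpha,\beta,\gamma)$ for $\alpha,\beta,\gamma\in\mathbb Z$ by $c_v(\alpha,\beta,\gamma)=0$ if any argument is negative, $c_v(0,0,0)=1$, and, for all other $\alpha,\beta,\gamma\ge0$, $$\begin{aligned}c_v(\alpha,\beta,\gamma)={}&(2\alpha+8\beta+12\gamma-1)\,c_v(\alpha-1,\beta,\gamma)-2(\alpha+1)\,c_v(\alpha+1,\beta-1,\gamma)\\&-8(\beta+1)\,c_v(\alpha,\beta+1,\gamma-1)-12(\gamma+1)\,c_v(\alpha,\beta-2,\gamma+1).\end{aligned}$$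 Then all the series above converge absolutely, the denominator of $V_{2t}(q)$ is nonzero, and for every integer $t\ge0$ $$V_{2t}(q)=\sum_{\substack{\alpha,\beta,\gamma\ge0\\ \alpha+2\beta+3\gamma=t}}c_v(\alpha,\beta,\gamma)\,E_2(q)^{\alpha}E_4(q)^{\beta}E_6(q)^{\gamma}.$$ -/

import Mathlib

namespace RamanujanV

/-- The summand `(σ_{2k-1}(n)) q^n`, `n ≥ 1`, of the Eisenstein series `E_{2k}`. -/
noncomputable def eisensteinTerm (k : ℕ) (q : ℂ) (n : ℕ+) : ℂ :=
  (ArithmeticFunction.sigma (2 * k - 1) (n : ℕ) : ℂ) * q ^ (n : ℕ)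

/-- The Eisenstein series `E_{2k}(q) = 1 - (4k / B_{2k}) ∑_{n ≥ 1} σ_{2k-1}(n) q^n`, for `k ≥ 1`.
The index is `k`, so `eisenstein 1`, `eisenstein 2`, `eisenstein 3` are `E_2`, `E_4`, `E_6`. -/
noncomputable def eisenstein (k : ℕ) (q : ℂ) : ℂ :=
  1 - (4 * (k : ℂ) / ((bernoulli (2 * k) : ℚ) : ℂ)) * ∑' n : ℕ+, eisensteinTerm k q n

/-- The term `(-1)^n (6n-1)^{2t} q^{n(3n-1)/2}`, `n ∈ ℤ`. In the order `n = 0, 1, -1, 2, -2, …`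
these are `1^{2t}`, `-5^{2t} q`, `-7^{2t} q^2`, `11^{2t} q^5`, `13^{2t} q^7`, …. -/
noncomputable def numeratorTerm (t : ℕ) (q : ℂ) (n : ℤ) : ℂ :=
  ((n.negOnePow : ℤ) : ℂ) * ((6 * n - 1 : ℤ) : ℂ) ^ (2 * t) * q ^ pentagonal n

/-- The term `(-1)^n q^{n(3n-1)/2}`, `n ∈ ℤ`. In the order `n = 0, 1, -1, 2, -2, …`
these are `1`, `-q`, `-q^2`, `q^5`, `q^7`, …. -/
noncomputable def denominatorTerm (q : ℂ) (n : ℤ) : ℂ :=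
  ((n.negOnePow : ℤ) : ℂ) * q ^ pentagonal n

/-- Ramanujan's `V_{2t}(q)`. -/
noncomputable def V (t : ℕ) (q : ℂ) : ℂ :=
  (∑' n : ℤ, numeratorTerm t q n) / (∑' n : ℤ, denominatorTerm q n)

/-- The integers `c_v(α, β, γ)`: zero if an argument is negative, `c_v(0, 0, 0) = 1`, and
otherwise given by the four-term recursion. -/
def cv (α β γ : ℤ) : ℤ :=
  if α < 0 ∨ β < 0 ∨ γ < 0 then 0
  else if α = 0 ∧ β = 0 ∧ γ = 0 then 1
  else
    (2 * α + 8 * β + 12 * γ - 1) * cv (α - 1) β γ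
      - 2 * (α + 1) * cv (α + 1) (β - 1) γ
      - 8 * (β + 1) * cv α (β + 1) (γ - 1)
      - 12 * (γ + 1) * cv α (β - 2) (γ + 1)
termination_by (α + 2 * β + 3 * γ).toNat
decreasing_by all_goals omega

/-- The triples `(α, β, γ)` of non-negative integers with `α + 2β + 3γ = t`. -/
def weightTriples (t : ℕ) : Finset (ℕ × ℕ × ℕ) :=
  (Finset.range (t + 1) ×ˢ Finset.range (t + 1) ×ˢ Finset.range (t + 1)).filter
    fun p => p.1 + 2 * p.2.1 + 3 * p.2.2 = t

/-- The bounds in `weightTriples` exclude no solution. -/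
theorem mem_weightTriples (t α β γ : ℕ) :
    (α, β, γ) ∈ weightTriples t ↔ α + 2 * β + 3 * γ = t := by
  simp only [weightTriples, Finset.mem_filter, Finset.mem_product, Finset.mem_range]
  omega

end RamanujanV

/-!
Since `24 · n(3n-1)/2 + 1 = (6n-1)²`, the numerators `N_t` of `V_{2t}` satisfy
`N_{t+1} = N_t + 24 q N_t'`, and by Euler's pentagonal number theorem `N_0` is `∏ (1 - qⁿ)`, whose
logarithmic derivative gives `N_1 = E₂ N_0`. Hence `V_{2t+2} = E₂ V_{2t} + 24 q V_{2t}'`.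
Ramanujan's differential equations make `24 q d/dq` a derivation of `ℤ[E₂, E₄, E₆]`, and on
coefficients this recursion is the one that defines `c_v`. The differential equations hold because
the difference of their two sides is a cusp form of level one and weight less than twelve; for `E₂'`
the quasimodular correction terms cancel.
-/

namespace RamanujanV

open Filter Function Metric Topology

/-! ### Euler's pentagonal number theorem in a complete normed field -/

section Pentagonal

variable {𝕜 : Type*} [NormedField 𝕜] {q : 𝕜}

lemma norm_prod_one_sub_pow_le (hq : ‖q‖ < 1) (k n : ℕ) :
    ‖∏ i ∈ Finset.range n, (1 - q ^ (k + i + 1))‖ ≤ Real.exp (1 - ‖q‖)⁻¹ := by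
  have hs := summable_geometric_of_lt_one (norm_nonneg q) hq
  calc ‖∏ i ∈ Finset.range n, (1 - q ^ (k + i + 1))‖
      ≤ ∏ i ∈ Finset.range n, (1 + ‖q‖ ^ i) := by
        rw [norm_prod]
        refine Finset.prod_le_prod (fun _ _ ↦ norm_nonneg _) fun i _ ↦ ?_
        refine (norm_sub_le _ _).trans ?_
        rw [norm_one, norm_pow]
        have := pow_le_pow_of_le_one (norm_nonneg q) hq.le (show i ≤ k + i + 1 by lia)
        gcongr
    _ ≤ Real.exp (∑ i ∈ Finset.range n, ‖q‖ ^ i) :=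
        Real.prod_one_add_le_exp_sum _ fun _ ↦ by positivity
    _ ≤ Real.exp (1 - ‖q‖)⁻¹ := by
        rw [Real.exp_le_exp, ← tsum_geometric_of_lt_one (norm_nonneg q) hq]
        exact hs.sum_le_tsum _ fun _ _ ↦ by positivity

lemma norm_pow_mul_prod_one_sub_pow_le (hq : ‖q‖ < 1) (k n : ℕ) :
    ‖q ^ ((k + 1) * n) * ∏ i ∈ Finset.range (n + 1), (1 - q ^ (k + i + 1))‖ ≤
      ‖q‖ ^ n * Real.exp (1 - ‖q‖)⁻¹ := by
  rw [norm_mul, norm_pow]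
  gcongr ?_ * ?_
  · exact pow_le_pow_of_le_one (norm_nonneg q) hq.le (Nat.le_mul_of_pos_left n k.succ_pos)
  · exact norm_prod_one_sub_pow_le hq k (n + 1)

variable [CompleteSpace 𝕜]

lemma summable_negOnePow_mul_pow_pentagonal (hq : ‖q‖ < 1) :
    Summable fun n : ℤ ↦ ((n.negOnePow : ℤ) : 𝕜) * q ^ pentagonal n := by
  refine .of_norm (((summable_geometric_of_lt_one (norm_nonneg q) hq).comp_injective
    pentagonal_injective).congr fun n ↦ ?_)
  rcases Int.units_eq_one_or n.negOnePow with h | h <;> simp [h]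

lemma hasSum_neg_one_pow_mul_pow_pentagonal_sub (hq : ‖q‖ < 1) :
    HasSum (fun k : ℕ ↦ (-1) ^ k * (q ^ pentagonal (-k) - q ^ pentagonal (k + 1)))
      (∑' n : ℤ, ((n.negOnePow : ℤ) : 𝕜) * q ^ pentagonal n) := by
  have h := (summable_negOnePow_mul_pow_pentagonal hq).hasSum
  rw [← (Equiv.neg ℤ).hasSum_iff] at h
  convert h.nat_add_neg_add_one using 2 with k
  simp only [comp_apply, Equiv.neg_apply, neg_neg, Int.negOnePow_add, Int.negOnePow_neg]
  simp only [Int.coe_negOnePow, Int.natAbs_natCast, Int.negOnePow_one, mul_neg, mul_one,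
    Units.val_neg, Int.cast_neg, neg_mul]
  ring

theorem tprod_one_sub_pow_eq_tsum_pentagonal (hq : ‖q‖ < 1) :
    ∏' n : ℕ, (1 - q ^ (n + 1)) = ∑' n : ℤ, ((n.negOnePow : ℤ) : 𝕜) * q ^ pentagonal n := by
  have hs := summable_geometric_of_lt_one (norm_nonneg q) hq
  have hpent := hasSum_neg_one_pow_mul_pow_pentagonal_sub hq
  rw [← hpent.tsum_eq]
  refine Pentagonal.tprod_one_sub_pow (tendsto_pow_atTop_nhds_zero_of_norm_lt_one hq)
    (fun k ↦ ?_) (fun k ↦ ?_) hpent.summable ?_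
  · exact .of_norm_bounded (hs.mul_right _) fun n ↦ norm_pow_mul_prod_one_sub_pow_le hq k n
  · have := multipliable_one_add_of_summable (f := fun n : ℕ ↦ -q ^ (n + k + 1)) (by
      simpa [add_assoc] using (summable_nat_add_iff (k + 1)).2 hs)
    simpa [sub_eq_add_neg] using this
  · set M := (1 - ‖q‖)⁻¹ * Real.exp (1 - ‖q‖)⁻¹
    have hbound (k : ℕ) : ‖(-1) ^ (k + 1) * q ^ ((k + 1) * (3 * k + 4) / 2) *
        ∑' n : ℕ, q ^ ((k + 1) * n) * ∏ i ∈ Finset.range (n + 1), (1 - q ^ (k + i + 1))‖ ≤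
          ‖q‖ ^ k * M := by
      rw [norm_mul, norm_mul, norm_pow, norm_pow, norm_neg, norm_one, one_pow, one_mul]
      gcongr ?_ * ?_
      · exact pow_le_pow_of_le_one (norm_nonneg q) hq.le (by grind)
      · exact tsum_of_norm_bounded ((hasSum_geometric_of_lt_one (norm_nonneg q) hq).mul_right _)
          fun n ↦ norm_pow_mul_prod_one_sub_pow_le hq k n
    refine squeeze_zero_norm hbound ?_
    simpa using (tendsto_pow_atTop_nhds_zero_of_lt_one (norm_nonneg q) hq).mul_const M

lemma tprod_one_sub_pow_ne_zero (hq : ‖q‖ < 1) : ∏' n : ℕ, (1 - q ^ (n + 1)) ≠ 0 := by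
  simp only [sub_eq_add_neg]
  refine tprod_one_add_ne_zero_of_summable (fun n h ↦ ?_) ?_
  · have h_norm : ‖q ^ (n + 1)‖ = 1 := by rw [← add_neg_eq_zero.1 h, norm_one]
    exact (pow_lt_one₀ (norm_nonneg q) hq n.succ_ne_zero).ne (norm_pow q _ ▸ h_norm)
  · simpa using (summable_nat_add_iff 1).2 (summable_geometric_of_lt_one (norm_nonneg q) hq)

end Pentagonal

/-! ### Power series as sums of monomials -/

section MonomialSeries

variable {ι : Type*} {a : ι → ℂ} {m : ι → ℕ} {R : ℝ}

lemma exists_summable_norm_mul_pow_le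
    (h : ∀ q ∈ ball (0 : ℂ) R, Summable fun i ↦ a i * q ^ m i) {q : ℂ} (hq : q ∈ ball 0 R) :
    ∃ r : ℝ, q ∈ ball 0 r ∧ ∃ u : ι → ℝ, Summable u ∧
      ∀ i, ∀ w ∈ ball (0 : ℂ) r, ‖a i * w ^ m i‖ ≤ u i := by
  obtain ⟨r, hqr, hrR⟩ := exists_between (mem_ball_zero_iff.1 hq)
  have hr : ‖(r : ℂ)‖ = r := Complex.norm_of_nonneg ((norm_nonneg q).trans hqr.le)
  refine ⟨r, mem_ball_zero_iff.2 hqr, _, (h r (mem_ball_zero_iff.2 (hr.trans_lt hrR))).norm,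
    fun i w hw ↦ ?_⟩
  rw [norm_mul, norm_mul, norm_pow, norm_pow, hr]
  gcongr
  exact (mem_ball_zero_iff.1 hw).le

lemma differentiableOn_tsum_mul_pow
    (h : ∀ q ∈ ball (0 : ℂ) R, Summable fun i ↦ a i * q ^ m i) :
    DifferentiableOn ℂ (fun q ↦ ∑' i, a i * q ^ m i) (ball 0 R) := by
  intro q hq
  obtain ⟨r, hqr, u, hu, hle⟩ := exists_summable_norm_mul_pow_le h hq
  have hd : DifferentiableOn ℂ (fun q ↦ ∑' i, a i * q ^ m i) (ball 0 r) :=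
    Complex.differentiableOn_tsum_of_summable_norm hu (fun i ↦ by fun_prop) isOpen_ball hle
  exact (hd.differentiableAt (isOpen_ball.mem_nhds hqr)).differentiableWithinAt

lemma hasSum_mul_deriv_tsum_mul_pow
    (h : ∀ q ∈ ball (0 : ℂ) R, Summable fun i ↦ a i * q ^ m i) {q : ℂ} (hq : q ∈ ball 0 R) :
    HasSum (fun i ↦ m i * (a i * q ^ m i)) (q * deriv (fun q ↦ ∑' i, a i * q ^ m i) q) := by
  obtain ⟨r, hqr, u, hu, hle⟩ := exists_summable_norm_mul_pow_le h hq
  have hterm (i : ι) : m i * (a i * q ^ m i) = q * deriv (fun w ↦ a i * w ^ m i) q := by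
    rw [deriv_const_mul_field, deriv_pow_field]
    cases m i with
    | zero => simp
    | succ n => rw [Nat.add_sub_cancel]; ring
  rw [funext hterm]
  exact (Complex.hasSum_deriv_of_summable_norm hu (fun i ↦ by fun_prop) isOpen_ball hle
    hqr).mul_left q

end MonomialSeries

/-! ### The numerators of `V` -/

lemma twentyFour_mul_pentagonal_add_one (n : ℤ) :
    24 * (pentagonal n : ℤ) + 1 = (6 * n - 1) ^ 2 := by
  linear_combination 12 * two_mul_natCast_pentagonal n

lemma numeratorTerm_zero (q : ℂ) : numeratorTerm 0 q = denominatorTerm q := by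
  ext n
  simp [numeratorTerm, denominatorTerm]

lemma numeratorTerm_succ (t : ℕ) (q : ℂ) (n : ℤ) :
    numeratorTerm (t + 1) q n =
      numeratorTerm t q n + 24 * (pentagonal n * numeratorTerm t q n) := by
  have h : (24 * pentagonal n + 1 : ℂ) = ((6 * n - 1 : ℤ) : ℂ) ^ 2 := by
    exact_mod_cast twentyFour_mul_pentagonal_add_one n
  simp only [numeratorTerm]
  rw [mul_add_one, pow_add, ← h]
  ring

/-- The numerator of `V t`, whose terms for `t = 0` are those of the denominator. -/
noncomputable def numerator (t : ℕ) (q : ℂ) : ℂ := ∑' n : ℤ, numeratorTerm t q n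

lemma summable_numeratorTerm (t : ℕ) {q : ℂ} (hq : ‖q‖ < 1) : Summable (numeratorTerm t q) := by
  induction t generalizing q with
  | zero => exact numeratorTerm_zero q ▸ summable_negOnePow_mul_pow_pentagonal hq
  | succ t ih =>
    have h := hasSum_mul_deriv_tsum_mul_pow (fun w hw ↦ ih (mem_ball_zero_iff.1 hw))
      (mem_ball_zero_iff.2 hq)
    exact ((ih hq).add (h.summable.mul_left 24)).congr fun n ↦ (numeratorTerm_succ t q n).symm

lemma differentiableOn_numerator (t : ℕ) : DifferentiableOn ℂ (numerator t) (ball 0 1) :=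
  differentiableOn_tsum_mul_pow fun _ hq ↦ summable_numeratorTerm t (mem_ball_zero_iff.1 hq)

lemma numerator_succ (t : ℕ) {q : ℂ} (hq : ‖q‖ < 1) :
    numerator (t + 1) q = numerator t q + 24 * (q * deriv (numerator t) q) := by
  have h := hasSum_mul_deriv_tsum_mul_pow
    (fun w hw ↦ summable_numeratorTerm t (mem_ball_zero_iff.1 hw)) (mem_ball_zero_iff.2 hq)
  rw [numerator, funext (numeratorTerm_succ t q)]
  exact ((summable_numeratorTerm t hq).hasSum.add (h.mul_left 24)).tsum_eq

/-! ### Eisenstein series -/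

lemma summable_eisensteinTerm (k : ℕ) {q : ℂ} (hq : ‖q‖ < 1) :
    Summable (eisensteinTerm k q) := by
  have hσ : (fun n : ℕ ↦ (ArithmeticFunction.sigma (2 * k - 1) n : ℝ)) =O[atTop]
      fun n ↦ ((n ^ (2 * k - 1 + 1) : ℕ) : ℝ) :=
    .of_norm_le fun n ↦ by
      rw [Real.norm_natCast]
      exact_mod_cast ArithmeticFunction.sigma_le_pow_succ _ n
  exact (summable_norm_mul_geometric_of_norm_lt_one hq hσ).of_norm.comp_injective PNat.coe_injective

lemma differentiableOn_eisenstein (k : ℕ) : DifferentiableOn ℂ (eisenstein k) (ball 0 1) :=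
  ((differentiableOn_tsum_mul_pow fun _ hq ↦
    summable_eisensteinTerm k (mem_ball_zero_iff.1 hq)).const_mul _).const_sub 1

lemma eisenstein_zero_right (k : ℕ) : eisenstein k 0 = 1 := by
  simp [eisenstein, eisensteinTerm]

open UpperHalfPlane hiding I
open Function.Periodic EisensteinSeries ModularForm Derivative
open Complex (I I_sq)
open scoped MatrixGroups Manifold Real

/-! ### Ramanujan's differential equations -/

section Modular

variable {F : ℂ → ℂ}

lemma qParam_one_mem_ball (z : ℍ) : qParam 1 z ∈ ball (0 : ℂ) 1 := by
  simpa using norm_qParam_lt_one 1 z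

lemma exists_qParam_one_eq {q : ℂ} (hq : q ∈ ball 0 1) (hq₀ : q ≠ 0) : ∃ z : ℍ, qParam 1 z = q :=
  ⟨⟨_, im_invQParam_pos_of_norm_lt_one one_pos (mem_ball_zero_iff.1 hq) hq₀⟩,
    qParam_right_inv one_ne_zero hq₀⟩

lemma hasDerivAt_qParam (h : ℝ) (z : ℂ) :
    HasDerivAt (qParam h) (2 * π * I / h * qParam h z) z := by
  refine (differentiable_qParam z).hasDerivAt.congr_deriv ?_
  rw [← logDeriv_qParam h z, logDeriv_apply, div_mul_cancel₀ _ (qParam_ne_zero z)]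

lemma hasDerivAt_comp_qParam_one (hF : DifferentiableOn ℂ F (ball 0 1)) (z : ℍ) :
    HasDerivAt ((fun z : ℍ ↦ F (qParam 1 z)) ∘ ofComplex)
      (2 * π * I * (qParam 1 z * deriv F (qParam 1 z))) z := by
  have h := (hF.differentiableAt (isOpen_ball.mem_nhds (qParam_one_mem_ball z))).hasDerivAt.comp
    (z : ℂ) (hasDerivAt_qParam 1 z)
  refine (h.congr_of_eventuallyEq ?_).congr_deriv (by push_cast; ring)
  filter_upwards [isOpen_upperHalfPlaneSet.mem_nhds z.im_pos] with w hw
  simp [ofComplex_apply_of_im_pos hw]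

lemma mdifferentiable_comp_qParam_one (hF : DifferentiableOn ℂ F (ball 0 1)) :
    MDiff fun z : ℍ ↦ F (qParam 1 z) :=
  fun z ↦ mdifferentiableAt_iff.2 (hasDerivAt_comp_qParam_one hF z).differentiableAt

lemma normalizedDeriv_comp_qParam_one (hF : DifferentiableOn ℂ F (ball 0 1)) (z : ℍ) :
    D (fun z : ℍ ↦ F (qParam 1 z)) z = qParam 1 z * deriv F (qParam 1 z) := by
  rw [normalizedDerivOfComplex, (hasDerivAt_comp_qParam_one hF z).deriv,
    inv_mul_cancel_left₀ Complex.two_pi_I_ne_zero]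

lemma eq_zero_of_slash_invariant_of_tendsto_zero {k : ℤ} (hk : k < 12) {f : ℍ → ℂ} (hf : MDiff f)
    (hinv : ∀ γ : SL(2, ℤ), f ∣[k] γ = f) (h0 : Tendsto f atImInfty (𝓝 0)) : f = 0 := by
  let F : CuspForm 𝒮ℒ k :=
    { toFun := f
      slash_action_eq' := fun _ ⟨γ, hγ⟩ ↦ hγ ▸ hinv γ
      holo' := hf
      zero_at_cusps' := fun {c} hc ↦ by
        rw [Subgroup.IsArithmetic.isCusp_iff_isCusp_SL2Z] at hc
        rw [OnePoint.isZeroAt_iff_forall_SL2Z hc]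
        intro γ _
        rw [hinv γ]
        exact h0 }
  have hF : F = 0 := rank_zero_iff_forall_zero.mp (CuspForm.rank_eq_zero_of_weight_lt_twelve hk) F
  exact congrArg DFunLike.coe hF

lemma eqOn_zero_of_slash_invariant {k : ℤ} (hk : k < 12)
    (hF : DifferentiableOn ℂ F (ball 0 1)) (hF₀ : F 0 = 0)
    (hinv : ∀ γ : SL(2, ℤ), (fun z : ℍ ↦ F (qParam 1 z)) ∣[k] γ = fun z : ℍ ↦ F (qParam 1 z)) :
    Set.EqOn F 0 (ball 0 1) := by
  intro q hq
  rcases eq_or_ne q 0 with rfl | hq₀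
  · exact hF₀
  obtain ⟨z, rfl⟩ := exists_qParam_one_eq hq hq₀
  have hlim : Tendsto F (𝓝 0) (𝓝 0) := by
    simpa only [hF₀] using (hF.differentiableAt (ball_mem_nhds 0 one_pos)).continuousAt.tendsto
  exact congrFun (eq_zero_of_slash_invariant_of_tendsto_zero hk (mdifferentiable_comp_qParam_one hF)
    hinv (hlim.comp (qParam_tendsto_atImInfty one_pos))) z

end Modular

lemma E2_eq_eisenstein : E2 = fun z : ℍ ↦ eisenstein 1 (qParam 1 z) := by
  ext z
  rw [E2_eq_tsum_cexp, eisenstein]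
  norm_num [eisensteinTerm, qParam, bernoulli_two]

lemma E₄_eq_eisenstein : ⇑E₄ = fun z : ℍ ↦ eisenstein 2 (qParam 1 z) := by
  ext z
  rw [E₄, q_expansion_bernoulli _ ⟨2, rfl⟩, eisenstein]
  norm_num [eisensteinTerm, qParam]

lemma E₆_eq_eisenstein : ⇑E₆ = fun z : ℍ ↦ eisenstein 3 (qParam 1 z) := by
  ext z
  rw [E₆, q_expansion_bernoulli _ ⟨3, rfl⟩, eisenstein]
  norm_num [eisensteinTerm, qParam]

lemma hasDerivAt_D2 (γ : SL(2, ℤ)) (z : ℍ) :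
    HasDerivAt (D2 γ ∘ ofComplex) (-(2 * π * I)⁻¹ * D2 γ z ^ 2) z := by
  have h := (hasDerivAt_denom_zpow (γ : GL (Fin 2) ℝ) (-1) z).const_mul (2 * π * I * (γ 1 0 : ℂ))
  have heq : D2 γ ∘ ofComplex =ᶠ[𝓝 (z : ℂ)] fun w ↦
      2 * π * I * (γ 1 0 : ℂ) * denom γ w ^ (-1 : ℤ) := by
    filter_upwards [isOpen_upperHalfPlaneSet.mem_nhds z.im_pos] with w hw
    simp [D2, ofComplex_apply_of_im_pos hw, div_eq_mul_inv]
  refine (h.congr_of_eventuallyEq heq).congr_deriv ?_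
  have hz := denom_ne_zero γ z
  rw [D2, show (-1 - 1 : ℤ) = -2 by norm_num, zpow_neg]
  simp only [Int.reduceNeg, Int.cast_neg, Int.cast_one, Matrix.SpecialLinearGroup.coe_GL_coe_matrix,
    Matrix.SpecialLinearGroup.map_apply_coe, RingHom.mapMatrix_apply, Int.coe_castRingHom,
    Matrix.map_apply, Complex.ofReal_intCast, zpow_ofNat]
  field_simp

lemma mdifferentiable_D2 (γ : SL(2, ℤ)) : MDiff (D2 γ) :=
  fun z ↦ mdifferentiableAt_iff.2 (hasDerivAt_D2 γ z).differentiableAt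

lemma normalizedDeriv_D2 (γ : SL(2, ℤ)) : D (D2 γ) = (4 * π ^ 2 : ℂ)⁻¹ • D2 γ ^ 2 := by
  ext z
  rw [normalizedDerivOfComplex, (hasDerivAt_D2 γ z).deriv, Pi.smul_apply, Pi.pow_apply,
    smul_eq_mul]
  field_simp
  linear_combination -4 * D2 γ z ^ 2 * I_sq

lemma modularForm_slash {k : ℤ} (f : ModularForm 𝒮ℒ k) (γ : SL(2, ℤ)) : ⇑f ∣[k] γ = f :=
  f.slash_action_eq' _ ⟨γ, rfl⟩

lemma exists_E2_slash_eq_sub (γ : SL(2, ℤ)) :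
    ∃ δ : ℍ → ℂ, MDiff δ ∧ E2 ∣[(2 : ℤ)] γ = E2 - δ ∧ D δ = (12⁻¹ : ℂ) • δ ^ 2 := by
  refine ⟨_, (mdifferentiable_D2 γ).const_smul _, E2_slash_action γ, ?_⟩
  rw [normalizedDerivOfComplex_smul _ _ (mdifferentiable_D2 γ), normalizedDeriv_D2,
    riemannZeta_two, smul_pow, smul_smul, smul_smul]
  congr 1
  field_simp
  norm_num

lemma serreDerivative_E2_add_slash (γ : SL(2, ℤ)) :
    (serreDerivative 2 E2 + (12⁻¹ : ℂ) • (E2 * E2)) ∣[(4 : ℤ)] γ =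
      serreDerivative 2 E2 + (12⁻¹ : ℂ) • (E2 * E2) := by
  obtain ⟨δ, hδ, hslash, hδ_deriv⟩ := exists_E2_slash_eq_sub γ
  have hmul : (E2 * E2) ∣[(4 : ℤ)] γ = (E2 - δ) * (E2 - δ) :=
    hslash ▸ mul_slash_SL2 2 2 γ E2 E2
  have hserre : serreDerivative 2 E2 ∣[(4 : ℤ)] γ = serreDerivative 2 (E2 - δ) :=
    hslash ▸ serreDerivative_slash_equivariant (k := 2) E2_mdifferentiable
  rw [SlashAction.add_slash, SL_smul_slash, hmul, hserre,
    serreDerivative_sub _ _ _ E2_mdifferentiable hδ]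
  ext z
  simp only [Pi.add_apply, Pi.sub_apply, Pi.smul_apply, Pi.mul_apply, serreDerivative_apply,
    hδ_deriv, Pi.pow_apply, smul_eq_mul]
  ring

lemma differentiableOn_mul_deriv {F : ℂ → ℂ} {r : ℝ} (hF : DifferentiableOn ℂ F (ball 0 r)) :
    DifferentiableOn ℂ (fun q ↦ q * deriv F q) (ball 0 r) :=
  differentiableOn_id.fun_mul (hF.deriv isOpen_ball)

lemma mul_deriv_eisenstein_one {q : ℂ} (hq : ‖q‖ < 1) :
    q * deriv (eisenstein 1) q = (eisenstein 1 q ^ 2 - eisenstein 2 q) / 12 := by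
  have hd := differentiableOn_eisenstein
  have h := eqOn_zero_of_slash_invariant (k := 4) (by norm_num)
    (F := fun q ↦ q * deriv (eisenstein 1) q - (eisenstein 1 q ^ 2 - eisenstein 2 q) / 12)
    ((differentiableOn_mul_deriv (hd 1)).fun_sub ((((hd 1).fun_pow 2).fun_sub (hd 2)).div_const 12))
    (by simp [eisenstein_zero_right]) fun γ ↦ by
      have heq : (fun z : ℍ ↦ qParam 1 z * deriv (eisenstein 1) (qParam 1 z) -
          (eisenstein 1 (qParam 1 z) ^ 2 - eisenstein 2 (qParam 1 z)) / 12) =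
          serreDerivative 2 E2 + (12⁻¹ : ℂ) • (E2 * E2) + (12⁻¹ : ℂ) • ⇑E₄ := by
        ext z
        simp only [E2_eq_eisenstein, E₄_eq_eisenstein, Pi.add_apply, Pi.smul_apply, Pi.mul_apply,
          smul_eq_mul, serreDerivative_apply, normalizedDeriv_comp_qParam_one (hd 1)]
        ring
      rw [heq, SlashAction.add_slash, serreDerivative_E2_add_slash, SL_smul_slash,
        modularForm_slash]
  exact sub_eq_zero.1 (h (mem_ball_zero_iff.2 hq))

lemma mul_deriv_eisenstein_two {q : ℂ} (hq : ‖q‖ < 1) :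
    q * deriv (eisenstein 2) q = (eisenstein 1 q * eisenstein 2 q - eisenstein 3 q) / 3 := by
  have hd := differentiableOn_eisenstein
  have h := eqOn_zero_of_slash_invariant (k := 6) (by norm_num)
    (F := fun q ↦ q * deriv (eisenstein 2) q -
      (eisenstein 1 q * eisenstein 2 q - eisenstein 3 q) / 3)
    ((differentiableOn_mul_deriv (hd 2)).fun_sub
      ((((hd 1).fun_mul (hd 2)).fun_sub (hd 3)).div_const 3))
    (by simp [eisenstein_zero_right]) fun γ ↦ by
      have heq : (fun z : ℍ ↦ qParam 1 z * deriv (eisenstein 2) (qParam 1 z) -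
          (eisenstein 1 (qParam 1 z) * eisenstein 2 (qParam 1 z) - eisenstein 3 (qParam 1 z)) / 3) =
          serreDerivative 4 E₄ + (3⁻¹ : ℂ) • ⇑E₆ := by
        ext z
        simp only [E2_eq_eisenstein, E₄_eq_eisenstein, E₆_eq_eisenstein, Pi.add_apply,
          Pi.smul_apply, smul_eq_mul, serreDerivative_apply, normalizedDeriv_comp_qParam_one (hd 2)]
        ring
      have hserre : serreDerivative 4 E₄ ∣[(6 : ℤ)] γ = serreDerivative 4 E₄ :=
        serreDerivative_slash_invariant (k := 4) E₄.holo' (modularForm_slash E₄ γ)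
      rw [heq, SlashAction.add_slash, hserre, SL_smul_slash, modularForm_slash]
  exact sub_eq_zero.1 (h (mem_ball_zero_iff.2 hq))

lemma mul_deriv_eisenstein_three {q : ℂ} (hq : ‖q‖ < 1) :
    q * deriv (eisenstein 3) q = (eisenstein 1 q * eisenstein 3 q - eisenstein 2 q ^ 2) / 2 := by
  have hd := differentiableOn_eisenstein
  have h := eqOn_zero_of_slash_invariant (k := 8) (by norm_num)
    (F := fun q ↦ q * deriv (eisenstein 3) q -
      (eisenstein 1 q * eisenstein 3 q - eisenstein 2 q ^ 2) / 2)
    ((differentiableOn_mul_deriv (hd 3)).fun_sub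
      ((((hd 1).fun_mul (hd 3)).fun_sub ((hd 2).fun_pow 2)).div_const 2))
    (by simp [eisenstein_zero_right]) fun γ ↦ by
      have heq : (fun z : ℍ ↦ qParam 1 z * deriv (eisenstein 3) (qParam 1 z) -
          (eisenstein 1 (qParam 1 z) * eisenstein 3 (qParam 1 z) -
            eisenstein 2 (qParam 1 z) ^ 2) / 2) =
          serreDerivative 6 E₆ + (2⁻¹ : ℂ) • (⇑E₄ * ⇑E₄) := by
        ext z
        simp only [E2_eq_eisenstein, E₄_eq_eisenstein, E₆_eq_eisenstein, Pi.add_apply,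
          Pi.smul_apply, Pi.mul_apply, smul_eq_mul, serreDerivative_apply,
          normalizedDeriv_comp_qParam_one (hd 3)]
        ring
      have hserre : serreDerivative 6 E₆ ∣[(8 : ℤ)] γ = serreDerivative 6 E₆ :=
        serreDerivative_slash_invariant (k := 6) E₆.holo' (modularForm_slash E₆ γ)
      have hmul : (⇑E₄ * ⇑E₄) ∣[(8 : ℤ)] γ = ⇑E₄ * ⇑E₄ :=
        (mul_slash_SL2 4 4 γ E₄ E₄).trans (by rw [modularForm_slash])
      rw [heq, SlashAction.add_slash, hserre, SL_smul_slash, hmul]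
  exact sub_eq_zero.1 (h (mem_ball_zero_iff.2 hq))

/-! ### The logarithmic derivative of the Euler product -/

lemma numerator_zero_ne_zero {q : ℂ} (hq : ‖q‖ < 1) : numerator 0 q ≠ 0 := by
  rw [numerator, numeratorTerm_zero]
  exact tprod_one_sub_pow_eq_tsum_pentagonal hq ▸ tprod_one_sub_pow_ne_zero hq

lemma eta_eq_qParam_mul_numerator (z : ℍ) : eta z = qParam 24 z * numerator 0 (qParam 1 z) := by
  have h := tprod_one_sub_pow_eq_tsum_pentagonal (mem_ball_zero_iff.1 (qParam_one_mem_ball z))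
  rw [numerator, numeratorTerm_zero]
  simp only [eta, eta_q_eq_pow, denominatorTerm, ← h]

/-- This is `V₂ = E₂`: the logarithmic derivative of `eta` is a multiple of `E2`. -/
lemma numerator_one {q : ℂ} (hq : ‖q‖ < 1) :
    numerator 1 q = eisenstein 1 q * numerator 0 q := by
  rw [numerator_succ 0 hq]
  rcases eq_or_ne q 0 with rfl | hq₀
  · simp [eisenstein_zero_right]
  obtain ⟨z, rfl⟩ := exists_qParam_one_eq (mem_ball_zero_iff.2 hq) hq₀
  have hN := hasDerivAt_comp_qParam_one (differentiableOn_numerator 0) z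
  have heta : eta =ᶠ[𝓝 (z : ℂ)] fun w ↦
      qParam 24 w * ((fun z : ℍ ↦ numerator 0 (qParam 1 z)) ∘ ofComplex) w := by
    filter_upwards [isOpen_upperHalfPlaneSet.mem_nhds z.im_pos] with w hw
    simpa [ofComplex_apply_of_im_pos hw] using eta_eq_qParam_mul_numerator ⟨w, hw⟩
  have h := logDeriv_eta_eq_E2 z
  have hN₀ := numerator_zero_ne_zero hq
  rw [logDeriv_apply, heta.deriv_eq, heta.eq_of_nhds, ← logDeriv_apply,
    logDeriv_mul (z : ℂ) (qParam_ne_zero _) (by simpa using hN₀) (by fun_prop)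
      hN.differentiableAt,
    logDeriv_qParam, logDeriv_apply, hN.deriv, E2_eq_eisenstein, comp_apply, ofComplex_apply] at h
  field_simp at h
  push_cast at h
  linear_combination h / 24

/-! ### The recursion for `cv` as a derivation on polynomials -/

section Polynomial

open MvPolynomial

lemma cv_of_neg {α β γ : ℤ} (h : α < 0 ∨ β < 0 ∨ γ < 0) : cv α β γ = 0 := by
  rw [cv, if_pos h]

lemma nonneg_of_cv_ne_zero {α β γ : ℤ} (h : cv α β γ ≠ 0) : 0 ≤ α ∧ 0 ≤ β ∧ 0 ≤ γ := by
  have := mt (cv_of_neg (α := α) (β := β) (γ := γ)) h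
  lia

lemma cv_of_mem_weightTriples_succ {t : ℕ} {p : ℕ × ℕ × ℕ} (hp : p ∈ weightTriples (t + 1)) :
    cv p.1 p.2.1 p.2.2 =
      (2 * p.1 + 8 * p.2.1 + 12 * p.2.2 - 1) * cv (p.1 - 1) p.2.1 p.2.2
        - 2 * (p.1 + 1) * cv (p.1 + 1) (p.2.1 - 1) p.2.2
        - 8 * (p.2.1 + 1) * cv p.1 (p.2.1 + 1) (p.2.2 - 1)
        - 12 * (p.2.2 + 1) * cv p.1 (p.2.1 - 2) (p.2.2 + 1) := by
  rw [mem_weightTriples] at hp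
  rw [cv, if_neg (by lia), if_neg (by lia)]

/-- The translation `p ↦ p + a - b` maps the triples of weight `t` to those of weight `t + 1`,
except where it leaves the octant of non-negative triples; `hf` makes `f` vanish there. -/
lemma sum_weightTriples_shift {M : Type*} [AddCommGroup M] {t : ℕ} (a b : ℕ × ℕ × ℕ)
    (hab : a.1 + 2 * a.2.1 + 3 * a.2.2 = b.1 + 2 * b.2.1 + 3 * b.2.2 + 1) {f : ℤ → ℤ → ℤ → ℤ}
    (hf : ∀ {α β γ}, f α β γ ≠ 0 → b.1 ≤ α ∧ b.2.1 ≤ β ∧ b.2.2 ≤ γ) (g : ℕ → ℕ → ℕ → M) :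
    ∑ p ∈ weightTriples t,
        f p.1 p.2.1 p.2.2 • g (p.1 + a.1 - b.1) (p.2.1 + a.2.1 - b.2.1) (p.2.2 + a.2.2 - b.2.2) =
      ∑ p ∈ weightTriples (t + 1),
        f (p.1 + b.1 - a.1) (p.2.1 + b.2.1 - a.2.1) (p.2.2 + b.2.2 - a.2.2) •
          g p.1 p.2.1 p.2.2 := by
  obtain ⟨a₁, a₂, a₃⟩ := a
  obtain ⟨b₁, b₂, b₃⟩ := b
  dsimp only at hab hf ⊢
  refine Finset.sum_bij_ne_zero
    (fun p _ _ ↦ (p.1 + a₁ - b₁, p.2.1 + a₂ - b₂, p.2.2 + a₃ - b₃)) ?_ ?_ ?_ ?_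
  · intro p hp h
    have := hf (left_ne_zero_of_smul h)
    rw [mem_weightTriples] at hp ⊢
    lia
  · intro p _ h p' _ h' heq
    have := hf (left_ne_zero_of_smul h)
    have := hf (left_ne_zero_of_smul h')
    grind
  · rintro ⟨α, β, γ⟩ hp h
    have := hf (left_ne_zero_of_smul h)
    rw [mem_weightTriples] at hp
    refine ⟨(α + b₁ - a₁, β + b₂ - a₂, γ + b₃ - a₃), ?_, ?_, ?_⟩
    · rw [mem_weightTriples]
      lia
    · convert h using 3 <;> dsimp only <;> lia
    · grind
  · intro p _ h
    have := hf (left_ne_zero_of_smul h)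
    dsimp only
    congr 2 <;> lia

/-- The polynomial `∑ cv α β γ X₀ ^ α X₁ ^ β X₂ ^ γ` over `α + 2β + 3γ = t`, whose value at
`(E₂, E₄, E₆)` is the right-hand side of the formula for `V t`. -/
noncomputable def cvPolynomial (t : ℕ) : MvPolynomial (Fin 3) ℤ :=
  ∑ p ∈ weightTriples t, cv p.1 p.2.1 p.2.2 • (X 0 ^ p.1 * X 1 ^ p.2.1 * X 2 ^ p.2.2)

/-- The derivation of `ℤ[X₀, X₁, X₂]` that corresponds to `24 q d/dq` under the substitution of
`E₂, E₄, E₆` for the variables, by Ramanujan's differential equations. -/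
noncomputable def ramanujanDerivation :
    Derivation ℤ (MvPolynomial (Fin 3) ℤ) (MvPolynomial (Fin 3) ℤ) :=
  mkDerivation ℤ ![2 * (X 0 ^ 2 - X 1), 8 * (X 0 * X 1 - X 2), 12 * (X 0 * X 2 - X 1 ^ 2)]

lemma ramanujanDerivation_monomial (α β γ : ℕ) :
    ramanujanDerivation (X 0 ^ α * X 1 ^ β * X 2 ^ γ) =
      (2 * α + 8 * β + 12 * γ : ℤ) • (X 0 ^ (α + 1) * X 1 ^ β * X 2 ^ γ)
        - (2 * α : ℤ) • (X 0 ^ (α - 1) * X 1 ^ (β + 1) * X 2 ^ γ)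
        - (8 * β : ℤ) • (X 0 ^ α * X 1 ^ (β - 1) * X 2 ^ (γ + 1))
        - (12 * γ : ℤ) • (X 0 ^ α * X 1 ^ (β + 2) * X 2 ^ (γ - 1)) := by
  simp only [ramanujanDerivation, Derivation.leibniz, Derivation.leibniz_pow, mkDerivation_X,
    smul_eq_mul, nsmul_eq_mul, zsmul_eq_mul]
  rcases α with _ | α <;> rcases β with _ | β <;> rcases γ with _ | γ <;> simp <;> ring

lemma cvPolynomial_zero : cvPolynomial 0 = 1 := by
  have h : weightTriples 0 = {(0, 0, 0)} := by decide
  simp [cvPolynomial, h, show cv 0 0 0 = 1 by rw [cv]; simp]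

lemma cvPolynomial_succ (t : ℕ) :
    cvPolynomial (t + 1) = X 0 * cvPolynomial t + ramanujanDerivation (cvPolynomial t) := by
  let M (α β γ : ℕ) : MvPolynomial (Fin 3) ℤ := X 0 ^ α * X 1 ^ β * X 2 ^ γ
  have h_mul := sum_weightTriples_shift (t := t) (1, 0, 0) (0, 0, 0) rfl
    (f := fun α β γ ↦ (1 + 2 * α + 8 * β + 12 * γ) * cv α β γ)
    (fun h ↦ nonneg_of_cv_ne_zero (right_ne_zero_of_mul h)) M
  have h_left := sum_weightTriples_shift (t := t) (0, 1, 0) (1, 0, 0) rfl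
    (f := fun α β γ ↦ 2 * α * cv α β γ)
    (fun h ↦ by have := nonneg_of_cv_ne_zero (right_ne_zero_of_mul h); grind) M
  have h_middle := sum_weightTriples_shift (t := t) (0, 0, 1) (0, 1, 0) rfl
    (f := fun α β γ ↦ 8 * β * cv α β γ)
    (fun h ↦ by have := nonneg_of_cv_ne_zero (right_ne_zero_of_mul h); grind) M
  have h_right := sum_weightTriples_shift (t := t) (0, 2, 0) (0, 0, 1) rfl
    (f := fun α β γ ↦ 12 * γ * cv α β γ)
    (fun h ↦ by have := nonneg_of_cv_ne_zero (right_ne_zero_of_mul h); grind) M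
  simp only [Nat.cast_zero, Nat.cast_one, Nat.cast_ofNat, add_zero, Nat.sub_zero, sub_zero]
    at h_mul h_left h_middle h_right
  calc cvPolynomial (t + 1)
      = ∑ p ∈ weightTriples t,
            ((1 + 2 * p.1 + 8 * p.2.1 + 12 * p.2.2) * cv p.1 p.2.1 p.2.2) •
              M (p.1 + 1) p.2.1 p.2.2
          - ∑ p ∈ weightTriples t,
            (2 * p.1 * cv p.1 p.2.1 p.2.2) • M (p.1 - 1) (p.2.1 + 1) p.2.2
          - ∑ p ∈ weightTriples t,
            (8 * p.2.1 * cv p.1 p.2.1 p.2.2) • M p.1 (p.2.1 - 1) (p.2.2 + 1)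
          - ∑ p ∈ weightTriples t,
            (12 * p.2.2 * cv p.1 p.2.1 p.2.2) • M p.1 (p.2.1 + 2) (p.2.2 - 1) := by
        rw [h_mul, h_left, h_middle, h_right]
        simp only [← Finset.sum_sub_distrib, ← sub_smul]
        refine Finset.sum_congr rfl fun p hp ↦ congrArg (· • M _ _ _) ?_
        rw [cv_of_mem_weightTriples_succ hp]
        ring
    _ = X 0 * cvPolynomial t + ramanujanDerivation (cvPolynomial t) := by
        simp only [cvPolynomial, Finset.mul_sum, map_sum, map_zsmul, ramanujanDerivation_monomial,
          ← Finset.sum_sub_distrib, ← Finset.sum_add_distrib, M]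
        refine Finset.sum_congr rfl fun p _ ↦ ?_
        simp only [zsmul_eq_mul]
        push_cast
        ring

end Polynomial

/-! ### Substituting Eisenstein series -/

section Evaluation

open MvPolynomial

/-- The substitution of `E₂(q)`, `E₄(q)`, `E₆(q)` for the three variables. -/
noncomputable def eisensteinEval (q : ℂ) : MvPolynomial (Fin 3) ℤ →ₐ[ℤ] ℂ :=
  aeval fun i ↦ eisenstein (i + 1) q

lemma eisensteinEval_X (q : ℂ) (i : Fin 3) : eisensteinEval q (X i) = eisenstein (i + 1) q :=
  aeval_X _ i

lemma differentiableOn_eisensteinEval (p : MvPolynomial (Fin 3) ℤ) :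
    DifferentiableOn ℂ (fun q ↦ eisensteinEval q p) (ball 0 1) := by
  induction p using MvPolynomial.induction_on with
  | C n => simp
  | add p₁ p₂ h₁ h₂ => simpa using h₁.fun_add h₂
  | mul_X p i h => simpa [eisensteinEval_X] using h.fun_mul (differentiableOn_eisenstein _)

lemma mul_deriv_eisenstein_eq_eisensteinEval {q : ℂ} (hq : ‖q‖ < 1) (i : Fin 3) :
    24 * (q * deriv (eisenstein (i + 1)) q) = eisensteinEval q (ramanujanDerivation (X i)) := by
  rw [ramanujanDerivation, mkDerivation_X]
  fin_cases i <;> simp [eisensteinEval, mul_deriv_eisenstein_one hq, mul_deriv_eisenstein_two hq,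
    mul_deriv_eisenstein_three hq] <;> ring

lemma mul_deriv_eisensteinEval (p : MvPolynomial (Fin 3) ℤ) {q : ℂ} (hq : ‖q‖ < 1) :
    24 * (q * deriv (fun q ↦ eisensteinEval q p) q) = eisensteinEval q (ramanujanDerivation p) := by
  have hball := isOpen_ball.mem_nhds (mem_ball_zero_iff.2 hq)
  have hd (p) := (differentiableOn_eisensteinEval p).differentiableAt hball
  induction p using MvPolynomial.induction_on with
  | C n => simp
  | add p₁ p₂ h₁ h₂ =>
    simp only [map_add, deriv_fun_add (hd p₁) (hd p₂), ← h₁, ← h₂]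
    ring
  | mul_X p i h =>
    have hi := (differentiableOn_eisenstein (i + 1)).differentiableAt hball
    simp only [map_mul, eisensteinEval_X, Derivation.leibniz, smul_eq_mul, map_add, ← h,
      ← mul_deriv_eisenstein_eq_eisensteinEval hq, deriv_fun_mul (hd p) hi]
    ring

lemma numerator_eq_eisensteinEval_mul (t : ℕ) {q : ℂ} (hq : ‖q‖ < 1) :
    numerator t q = eisensteinEval q (cvPolynomial t) * numerator 0 q := by
  induction t generalizing q with
  | zero => rw [cvPolynomial_zero, map_one, one_mul]
  | succ t ih =>
    have hball := isOpen_ball.mem_nhds (mem_ball_zero_iff.2 hq)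
    have heq : numerator t =ᶠ[𝓝 q] fun q ↦ eisensteinEval q (cvPolynomial t) * numerator 0 q := by
      filter_upwards [hball] with w hw using ih (mem_ball_zero_iff.1 hw)
    have h_one := numerator_one hq
    rw [numerator_succ 0 hq] at h_one
    rw [numerator_succ t hq, heq.deriv_eq, ih hq,
      deriv_fun_mul ((differentiableOn_eisensteinEval _).differentiableAt hball)
        ((differentiableOn_numerator 0).differentiableAt hball),
      cvPolynomial_succ, map_add, map_mul, eisensteinEval_X, ← mul_deriv_eisensteinEval _ hq]
    simp only [Fin.val_zero, zero_add]
    linear_combination eisensteinEval q (cvPolynomial t) * h_one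

lemma eisensteinEval_cvPolynomial (t : ℕ) (q : ℂ) :
    eisensteinEval q (cvPolynomial t) =
      ∑ p ∈ weightTriples t, (cv p.1 p.2.1 p.2.2 : ℂ) * eisenstein 1 q ^ p.1 *
        eisenstein 2 q ^ p.2.1 * eisenstein 3 q ^ p.2.2 := by
  simp [cvPolynomial, eisensteinEval_X, mul_assoc]

end Evaluation

end RamanujanV

theorem theorem1p2 (t : ℕ) (q : ℂ) (hq : ‖q‖ < 1) :
    Summable (RamanujanV.numeratorTerm t q) ∧
    Summable (RamanujanV.denominatorTerm q) ∧
    (∑' n : ℤ, RamanujanV.denominatorTerm q n) ≠ 0 ∧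
    (∀ k : ℕ, 1 ≤ k → Summable (RamanujanV.eisensteinTerm k q)) ∧
    RamanujanV.V t q =
      ∑ p ∈ RamanujanV.weightTriples t,
        (RamanujanV.cv p.1 p.2.1 p.2.2 : ℂ) *
          RamanujanV.eisenstein 1 q ^ p.1 *
          RamanujanV.eisenstein 2 q ^ p.2.1 *
          RamanujanV.eisenstein 3 q ^ p.2.2 := by
  have h_ne : ∑' n, RamanujanV.denominatorTerm q n ≠ 0 :=
    RamanujanV.numeratorTerm_zero q ▸ RamanujanV.numerator_zero_ne_zero hq
  refine ⟨RamanujanV.summable_numeratorTerm t hq,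
    RamanujanV.numeratorTerm_zero q ▸ RamanujanV.summable_numeratorTerm 0 hq, h_ne,
    fun k _ ↦ RamanujanV.summable_eisensteinTerm k hq, ?_⟩
  rw [RamanujanV.V, div_eq_iff h_ne, ← RamanujanV.eisensteinEval_cvPolynomial,
    ← RamanujanV.numeratorTerm_zero]
  exact RamanujanV.numerator_eq_eisensteinEval_mul t hq
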